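/- Let $B$ be a unital complex Banach algebra with unit $e$, let $b\in B$ be invertible, and let $\lambda_1,\dots,\lambda_n$ be distinct complex numbers. Let $\mathbb T$ be the unit circle, and call $b$ doubly power-bounded if $\sup_{k\in\mathbb Z}\|b^k\|<\infty$. The following are equivalent. (i) $b$ is doubly power-bounded and $\sigma(b)=\{\lambda_1,\dots,\lambda_n\}$. (ii) $\{\lambda_1,\dots,\lambda_n\}\subset\mathbb T$, and there exist non-zero idempotents $p_1,\dots,p_n\in B$ with $\sum_{j=1}^n p_j=e$ and $p_ip_j=\delta_{ij}p_i$ for $1\le i,j\le n$ such that $b=\sum_{j=1}^n\lambda_jp_j$. (iii) $\{\lambda_1,\dots,\lambda_n\}\subset\mathbb T$, $\prod_{j=1}^n(b-\lambda_je)=0$, and for every $1\le i\le n$ the element $$p_i=\prod_{j\ne i}\frac{b-\lambda_je}{\lambda_i-\lambda_j}$$ (read as $p_1=e$ if $n=1$) is non-zero. In this case, the idempotents $p_1,\dots,p_n$ in (ii) are necessarily the elements given by the formula in (iii), and, if $n>1$, each $p_i$ is the Riesz projection of $b$ corresponding to $\lambda_i$: the point $\lambda_i$ is isolated in $\sigma(b)$,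 and $$p_i=\frac1{2\pi i}\int_\Gamma(we-b)^{-1}\,dw$$ (where the $i$ in $2\pi i$ is the imaginary unit) for every contour $\Gamma$ in $\mathbb C\setminus\sigma(b)$ separating $\lambda_i$ from $\sigma(b)\setminus\{\lambda_i\}$, that is, every finite family of closed rectifiable curves in $\mathbb C\setminus\sigma(b)$ whose winding number is $1$ around $\lambda_i$ and $0$ around every other point of $\sigma(b)$; and such contours exist. -/

import Mathlib

/-- An invertible element `b` of a normed ring is doubly power-bounded if
`sup_{k ∈ ℤ} ‖b ^ k‖ < ∞`. -/
def IsDoublyPowerBounded {B : Type*} [NormedRing B] (b : Bˣ) : Prop :=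
  BddAbove (Set.range fun k : ℤ => ‖((b ^ k : Bˣ) : B)‖)

/-- A contour in the complex plane: a finite family of closed curves of finite length, each one
parametrized on the unit interval by a Lipschitz map (for instance proportionally to arc length). -/
structure Contour where
  /-- The number of closed curves. -/
  size : ℕ
  /-- The common start and end point of each curve. -/
  base : Fin size → ℂ
  /-- The closed curves. -/
  path : ∀ k, Path (base k) (base k)
  lipschitz : ∀ k, ∃ K : NNReal, LipschitzWith K (path k)

namespace Contour

/-- The set of points on the contour. -/
def trace (Γ : Contour) : Set ℂ := ⋃ k, Set.range (Γ.path k)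

/-- The integral `∫_Γ f(w) dw` of a vector-valued function along the contour. -/
noncomputable def integral {E : Type*} [NormedAddCommGroup E] [NormedSpace ℂ E]
    (Γ : Contour) (f : ℂ → E) : E :=
  ∑ k, curveIntegral (fun w => ContinuousLinearMap.toSpanSingleton ℂ (f w)) (Γ.path k)

/-- The winding number `(2πi)⁻¹ ∫_Γ (w - z)⁻¹ dw` of the contour around a point `z` off it. -/
noncomputable def windingNumber (Γ : Contour) (z : ℂ) : ℂ :=
  (2 * (Real.pi : ℂ) * Complex.I)⁻¹ * Γ.integral fun w => (w - z)⁻¹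

/-- `Γ` runs in the resolvent set of `a`, winds once around `lam` in the positive direction, and
does not wind around any other point of the spectrum of `a`. -/
def Separates {B : Type*} [NormedRing B] [NormedAlgebra ℂ B] (Γ : Contour) (a : B) (lam : ℂ) :
    Prop :=
  Γ.trace ⊆ resolventSet ℂ a ∧ Γ.windingNumber lam = 1 ∧
    ∀ z ∈ spectrum ℂ a, z ≠ lam → Γ.windingNumber z = 0

end Contour

/-- `p` is the Riesz projection of `a` corresponding to `lam`: the point `lam` is isolated in the
spectrum of `a`, and `p = (2πi)⁻¹ ∫_Γ (w e - a)⁻¹ dw` for every contour `Γ` in the resolvent set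
that separates `lam` from the rest of the spectrum (such contours being available). -/
def IsRieszProjection {B : Type*} [NormedRing B] [NormedAlgebra ℂ B] (a : B) (lam : ℂ) (p : B) :
    Prop :=
  (∃ ε : ℝ, 0 < ε ∧ Metric.ball lam ε ∩ spectrum ℂ a = {lam}) ∧
  (∃ Γ : Contour, Γ.Separates a lam) ∧
  ∀ Γ : Contour, Γ.Separates a lam →
    p = (2 * (Real.pi : ℂ) * Complex.I)⁻¹ • Γ.integral fun w => resolvent a w

/-- The `p i` are non-zero idempotents with `p i * p j = 0` for `i ≠ j` and `∑ p j = e`, and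
`b = ∑ lam j • p j`. -/
def IsSpectralDecomposition {B : Type*} [NormedRing B] [NormedAlgebra ℂ B] {n : ℕ} (b : B)
    (lam : Fin n → ℂ) (p : Fin n → B) : Prop :=
  (∀ i, p i ≠ 0) ∧ (∑ j, p j = 1) ∧ (∀ i j, p i * p j = if i = j then p i else 0) ∧
    b = ∑ j, lam j • p j

/-- The element `∏_{j ≠ i} (b - lam j e) / (lam i - lam j)`, which is `e` when `n = 1`. The factors
commute; they are multiplied in increasing order of `j`. -/
noncomputable def lagrangeElement {B : Type*} [NormedRing B] [NormedAlgebra ℂ B] {n : ℕ} (b : B)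
    (lam : Fin n → ℂ) (i : Fin n) : B :=
  (((List.finRange n).filter fun j => j ≠ i).map fun j =>
    (lam i - lam j)⁻¹ • (b - algebraMap ℂ B (lam j))).prod

/-! The substance is that double power-boundedness and a finite spectrum force `∏ (b - λ_j e) = 0`.
Neumann series inside and outside the unit circle give `‖R(w)‖ * |‖w‖ - 1| ≤ C` for the resolvent
`R`, and a maximum-principle argument (`norm_mul_norm_sub_le_of_unitCircle_growth`) upgrades this to
at most a simple pole at each `λ_j`. With `q = ∏ (b - λ_j e)`, the function `R(w) q` then has only
removable singularities and tends to `0` at infinity, so it vanishes by Liouville, and `q = 0`.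

The rest is Lagrange interpolation. Once `q = 0`, identities between the basis polynomials modulo
the nodal polynomial make their values at `b` orthogonal idempotents. Conversely, a decomposition
makes `f ↦ ∑ f_j p_j` multiplicative on `ℂ^n`, which yields the powers, the spectrum, the resolvent
and the uniqueness of the `p_j`. Integrating the resolvent leaves winding numbers as coefficients.
-/

open Polynomial

/-! ### Lagrange interpolation and the calculus of spectral decompositions. -/

section Algebra

variable {B : Type*} [NormedRing B] [NormedAlgebra ℂ B] {n : ℕ} {b : B} {lam : Fin n → ℂ}
  {p : Fin n → B}

theorem aeval_lagrangeBasis (b : B) (lam : Fin n → ℂ) (i : Fin n) :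
    aeval b (Lagrange.basis Finset.univ lam i) = lagrangeElement b lam i := by
  have hs : Finset.univ.erase i = ((List.finRange n).filter fun j => j ≠ i).toFinset := by
    ext j; simp
  rw [Lagrange.basis, hs, List.prod_toFinset _ ((List.nodup_finRange n).filter _),
    map_list_prod, List.map_map, lagrangeElement]
  congr 1
  refine List.map_congr_left fun j _ => ?_
  simp [Lagrange.basisDivisor, Algebra.smul_def]

theorem aeval_nodal_univ (b : B) (lam : Fin n → ℂ) :
    aeval b (Lagrange.nodal Finset.univ lam) =
      ((List.finRange n).map fun j => b - algebraMap ℂ B (lam j)).prod := by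
  rw [Lagrange.nodal_eq, Fin.prod_univ_def, map_list_prod, List.map_map]
  congr 1
  refine List.map_congr_left fun j _ => ?_
  simp

theorem X_sub_C_mul_lagrangeBasis (lam : Fin n → ℂ) (i : Fin n) :
    (X - C (lam i)) * Lagrange.basis Finset.univ lam i =
      C (∏ j ∈ Finset.univ.erase i, (lam i - lam j)⁻¹) * Lagrange.nodal Finset.univ lam := by
  simp only [Lagrange.basis, Lagrange.basisDivisor, Lagrange.nodal_eq, Finset.prod_mul_distrib,
    map_prod]
  rw [← Finset.mul_prod_erase Finset.univ (fun j => X - C (lam j)) (Finset.mem_univ i)]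
  ring

/-- The only root that the `i`-th basis polynomial lacks is `lam i`, and the `j`-th one supplies it.
-/
theorem nodal_dvd_lagrangeBasis_mul (lam : Fin n → ℂ) {i j : Fin n} (hij : i ≠ j) :
    Lagrange.nodal Finset.univ lam ∣
      Lagrange.basis Finset.univ lam i * Lagrange.basis Finset.univ lam j := by
  have hj : X - C (lam i) ∣ Lagrange.basis Finset.univ lam j :=
    (Dvd.intro_left (C (lam j - lam i)⁻¹) rfl).trans
      (Finset.dvd_prod_of_mem (fun k => Lagrange.basisDivisor (lam j) (lam k))
        (Finset.mem_erase.2 ⟨hij, Finset.mem_univ i⟩))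
  obtain ⟨q, hq⟩ := hj
  refine ⟨C (∏ j ∈ Finset.univ.erase i, (lam i - lam j)⁻¹) * q, ?_⟩
  rw [hq, mul_left_comm, ← mul_assoc, X_sub_C_mul_lagrangeBasis]
  ring

/-- If `∏ (b - lam j e) = 0`, the non-zero Lagrange elements decompose `b`. -/
theorem isSpectralDecomposition_lagrangeElement (hlam : Function.Injective lam)
    (h0 : ((List.finRange n).map fun j => b - algebraMap ℂ B (lam j)).prod = 0)
    (hne : ∀ i, lagrangeElement b lam i ≠ 0) :
    IsSpectralDecomposition b lam (lagrangeElement b lam) := by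
  have hsum : ∑ j, lagrangeElement b lam j = 1 := by
    -- For `n = 0` the empty product turns `h0` into `1 = 0`, which is the claim for the empty sum.
    rcases n with _ | m
    · simpa using h0.symm
    · simp_rw [← aeval_lagrangeBasis, ← map_sum]
      rw [Lagrange.sum_basis hlam.injOn Finset.univ_nonempty, map_one]
  have horth : ∀ i j, i ≠ j → lagrangeElement b lam i * lagrangeElement b lam j = 0 := by
    intro i j hij
    obtain ⟨q, hq⟩ := nodal_dvd_lagrangeBasis_mul lam hij
    rw [← aeval_lagrangeBasis, ← aeval_lagrangeBasis, ← map_mul, hq, map_mul, aeval_nodal_univ,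
      h0, zero_mul]
  have hb : ∀ i, b * lagrangeElement b lam i = lam i • lagrangeElement b lam i := by
    intro i
    have h := congrArg (aeval b) (X_sub_C_mul_lagrangeBasis lam i)
    rw [map_mul, map_mul, aeval_nodal_univ, h0, mul_zero, aeval_lagrangeBasis] at h
    simpa [sub_mul, sub_eq_zero, Algebra.smul_def] using h
  refine ⟨hne, hsum, fun i j => ?_, ?_⟩
  · split_ifs with hij
    · subst hij
      conv_rhs => rw [← mul_one (lagrangeElement b lam i), ← hsum, Finset.mul_sum]
      rw [Finset.sum_eq_single i (fun j _ hj => horth i j hj.symm) (by simp)]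
    · exact horth i j hij
  · simp_rw [← hb, ← Finset.mul_sum, hsum, mul_one]

namespace IsSpectralDecomposition

/-- Everything below on decompositions rests on this: computation with `∑ f_j p_j` is pointwise in
`f`. -/
theorem sum_smul_mul (h : IsSpectralDecomposition b lam p) (f g : Fin n → ℂ) :
    (∑ j, f j • p j) * ∑ j, g j • p j = ∑ j, (f j * g j) • p j := by
  simp_rw [Finset.sum_mul, Finset.mul_sum, smul_mul_smul_comm, h.2.2.1]
  simp

theorem sum_smul_one (h : IsSpectralDecomposition b lam p) : ∑ j, (1 : ℂ) • p j = 1 := by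
  simpa using h.2.1

theorem sum_smul_const (h : IsSpectralDecomposition b lam p) (c : ℂ) :
    ∑ j, c • p j = algebraMap ℂ B c := by
  rw [← Finset.smul_sum, h.2.1, Algebra.algebraMap_eq_smul_one]

theorem sum_smul_pow (h : IsSpectralDecomposition b lam p) (f : Fin n → ℂ) (m : ℕ) :
    (∑ j, f j • p j) ^ m = ∑ j, f j ^ m • p j := by
  induction m with
  | zero => simpa using h.2.1.symm
  | succ m ih => simp_rw [pow_succ, ih, h.sum_smul_mul]

theorem aeval_eq (h : IsSpectralDecomposition b lam p) (q : ℂ[X]) :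
    aeval b q = ∑ j, q.eval (lam j) • p j := by
  induction q using Polynomial.induction_on' with
  | add q r hq hr => simp [hq, hr, add_smul, Finset.sum_add_distrib]
  | monomial m c =>
    conv_lhs => rw [aeval_monomial, h.2.2.2, h.sum_smul_pow, ← Algebra.smul_def, Finset.smul_sum]
    simp [mul_smul]

theorem eq_lagrangeElement (h : IsSpectralDecomposition b lam p) (hlam : Function.Injective lam)
    (i : Fin n) : p i = lagrangeElement b lam i := by
  rw [← aeval_lagrangeBasis, h.aeval_eq, Finset.sum_eq_single i]
  · rw [Lagrange.eval_basis_self hlam.injOn (Finset.mem_univ i), one_smul]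
  · intro j _ hj
    rw [Lagrange.eval_basis_of_ne hj.symm (Finset.mem_univ j), zero_smul]
  · simp

theorem algebraMap_sub (h : IsSpectralDecomposition b lam p) (w : ℂ) :
    algebraMap ℂ B w - b = ∑ j, (w - lam j) • p j := by
  conv_lhs => rw [h.2.2.2, ← h.sum_smul_const]
  simp [sub_smul]

theorem algebraMap_sub_mul_sum (h : IsSpectralDecomposition b lam p) {w : ℂ}
    (hw : w ∉ Set.range lam) :
    (algebraMap ℂ B w - b) * ∑ j, (w - lam j)⁻¹ • p j = 1 ∧
      (∑ j, (w - lam j)⁻¹ • p j) * (algebraMap ℂ B w - b) = 1 := by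
  have hne : ∀ j, w - lam j ≠ 0 := fun j hj => hw ⟨j, (sub_eq_zero.1 hj).symm⟩
  rw [h.algebraMap_sub, h.sum_smul_mul, h.sum_smul_mul, ← h.sum_smul_one]
  constructor <;> refine Finset.sum_congr rfl fun j _ => ?_
  · rw [mul_inv_cancel₀ (hne j)]
  · rw [inv_mul_cancel₀ (hne j)]

theorem mem_resolventSet (h : IsSpectralDecomposition b lam p) {w : ℂ}
    (hw : w ∉ Set.range lam) : w ∈ resolventSet ℂ b :=
  ⟨⟨_, _, (h.algebraMap_sub_mul_sum hw).1, (h.algebraMap_sub_mul_sum hw).2⟩, rfl⟩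

theorem resolvent_eq (h : IsSpectralDecomposition b lam p) {w : ℂ} (hw : w ∉ Set.range lam) :
    resolvent b w = ∑ j, (w - lam j)⁻¹ • p j :=
  Ring.inverse_unit
    (⟨_, _, (h.algebraMap_sub_mul_sum hw).1, (h.algebraMap_sub_mul_sum hw).2⟩ : Bˣ)

theorem spectrum_eq (h : IsSpectralDecomposition b lam p) : spectrum ℂ b = Set.range lam := by
  refine Set.Subset.antisymm (fun w hw => ?_) ?_
  · by_contra hw'
    exact hw (h.mem_resolventSet hw')
  · rintro _ ⟨i, rfl⟩ hu
    have h0 : (algebraMap ℂ B (lam i) - b) * p i = 0 := by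
      -- The indicator of `i` represents `p i`, and its product with `lam i - lam j` is zero for
      -- every `j`.
      have := h.sum_smul_mul (fun j => lam i - lam j) (fun j => if j = i then 1 else 0)
      rw [← h.algebraMap_sub] at this
      simpa using this
    exact h.1 i (((hu : IsUnit _).mul_right_eq_zero).1 h0)

theorem isDoublyPowerBounded {b : Bˣ} (h : IsSpectralDecomposition (b : B) lam p)
    (hlam : ∀ j, lam j ∈ Metric.sphere (0 : ℂ) 1) : IsDoublyPowerBounded b := by
  have hnorm : ∀ j, ‖lam j‖ = 1 := fun j => by simpa using hlam j
  have hinv : ((b⁻¹ : Bˣ) : B) = ∑ j, (lam j)⁻¹ • p j := by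
    refine Units.inv_eq_of_mul_eq_one_right ?_
    conv_lhs => rw [h.2.2.2, h.sum_smul_mul]
    rw [← h.sum_smul_one]
    refine Finset.sum_congr rfl fun j _ => ?_
    rw [mul_inv_cancel₀ (norm_ne_zero_iff.1 (by simp [hnorm]))]
  have key : ∀ f : Fin n → ℂ, (∀ j, ‖f j‖ = 1) → ∀ m : ℕ,
      ‖(∑ j, f j • p j) ^ m‖ ≤ ∑ j, ‖p j‖ := by
    intro f hf m
    rw [h.sum_smul_pow]
    refine (norm_sum_le _ _).trans (Finset.sum_le_sum fun j _ => ?_)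
    simp [norm_smul, hf]
  refine ⟨∑ j, ‖p j‖, ?_⟩
  rintro _ ⟨k, rfl⟩
  obtain ⟨m, rfl | rfl⟩ := k.eq_nat_or_neg
  · have := key lam hnorm m
    rw [← h.2.2.2] at this
    simpa using this
  · have := key (fun j => (lam j)⁻¹) (by simp [hnorm]) m
    rw [← hinv] at this
    simpa [← inv_pow] using this

end IsSpectralDecomposition

end Algebra

/-! ### Removable singularities and Liouville's theorem. -/

section RemovableSingularities

open Filter Topology

/-- Punctured limits fill in all singularities at once: they agree with `f` off `T`, and near a
point of `T` Riemann's theorem applies because the other points of `T` stay away. -/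
theorem differentiable_limUnder_of_finite {E : Type*} [NormedAddCommGroup E] [NormedSpace ℂ E]
    [CompleteSpace E] {f : ℂ → E} {T : Set ℂ} (hT : T.Finite)
    (hd : ∀ w ∉ T, DifferentiableAt ℂ f w)
    (hb : ∀ c ∈ T, ∃ ε > 0, ∃ K : ℝ, ∀ w ∈ Metric.ball c ε, w ≠ c → ‖f w‖ ≤ K) :
    Differentiable ℂ fun w => limUnder (𝓝[≠] w) f := by
  have hfg : ∀ w ∉ T, limUnder (𝓝[≠] w) f = f w := fun w hw =>
    ((hd w hw).continuousAt.tendsto.mono_left nhdsWithin_le_nhds).limUnder_eq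
  intro c
  by_cases hc : c ∈ T
  · obtain ⟨ε, hε, K, hK⟩ := hb c hc
    have hopen : IsOpen (T \ {c})ᶜ := (hT.subset Set.sdiff_subset).isClosed.isOpen_compl
    have hnhds : Metric.ball c ε ∩ (T \ {c})ᶜ ∈ 𝓝 c :=
      inter_mem (Metric.ball_mem_nhds c hε) (hopen.mem_nhds (by simp))
    have hmem : ∀ w ∈ Metric.ball c ε ∩ (T \ {c})ᶜ, w ≠ c → w ∉ T :=
      fun w hw hwc hwT => hw.2 ⟨hwT, hwc⟩
    have hupd := Complex.differentiableOn_update_limUnder_of_bddAbove hnhds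
      (fun w hw => (hd w (hmem w hw.1 hw.2)).differentiableWithinAt)
      ⟨K, by rintro _ ⟨w, hw, rfl⟩; exact hK w hw.1.1 hw.2⟩
    refine (hupd.differentiableAt hnhds).congr_of_eventuallyEq ?_
    filter_upwards [hnhds] with w hw
    rcases eq_or_ne w c with rfl | hwc
    · simp
    · rw [Function.update_of_ne hwc, hfg w (hmem w hw hwc)]
  · refine (hd c hc).congr_of_eventuallyEq ?_
    filter_upwards [hT.isClosed.isOpen_compl.mem_nhds hc] with w hw using hfg w hw

/-- Liouville's theorem for a function with finitely many removable singularities. -/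
theorem eq_zero_of_tendsto_cocompact_of_finite {E : Type*} [NormedAddCommGroup E]
    [NormedSpace ℂ E] [CompleteSpace E] {f : ℂ → E} {T : Set ℂ} (hT : T.Finite)
    (hd : ∀ w ∉ T, DifferentiableAt ℂ f w)
    (hb : ∀ c ∈ T, ∃ ε > 0, ∃ K : ℝ, ∀ w ∈ Metric.ball c ε, w ≠ c → ‖f w‖ ≤ K)
    (h0 : Tendsto f (cocompact ℂ) (𝓝 0)) {w : ℂ} (hw : w ∉ T) : f w = 0 := by
  have hfg : ∀ w ∉ T, limUnder (𝓝[≠] w) f = f w := fun w hw =>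
    ((hd w hw).continuousAt.tendsto.mono_left nhdsWithin_le_nhds).limUnder_eq
  have hlim : Tendsto (fun w => limUnder (𝓝[≠] w) f) (cocompact ℂ) (𝓝 0) := by
    refine h0.congr' ?_
    filter_upwards [hT.isCompact.compl_mem_cocompact] with w hw using (hfg w hw).symm
  rw [← hfg w hw]
  exact (differentiable_limUnder_of_finite hT hd hb).apply_eq_of_tendsto_cocompact w hlim

end RemovableSingularities

/-! ### From growth near the unit circle to simple poles. -/

section CircleGrowth

variable {E : Type*} [NormedAddCommGroup E] [NormedSpace ℂ E]

/-- Multiplying by a quadratic that vanishes where `∂D(w₀, r)` meets the unit circle, the maximum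
principle bounds a function with growth `C / |‖w‖ - 1|` near the centre. -/
theorem norm_mul_le_of_unitCircle_growth {f : ℂ → E} {w₀ : ℂ} (hw₀ : ‖w₀‖ = 1) {r : ℝ}
    (hr : 0 < r) (hr1 : r ≤ 1) (hd : ∀ w ∈ Metric.closedBall w₀ r, DifferentiableAt ℂ f w) {C : ℝ}
    (hC : ∀ w ∈ Metric.sphere w₀ r, ‖f w‖ * |‖w‖ - 1| ≤ C) {w : ℂ}
    (hw : w ∈ Metric.closedBall w₀ (r / 4)) : ‖f w‖ * r ≤ 6 * C := by
  have hconj : w₀ * (starRingEnd ℂ) w₀ = 1 := by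
    rw [Complex.mul_conj, Complex.normSq_eq_norm_sq, hw₀]; simp
  have hr0 : (r : ℂ) ≠ 0 := by exact_mod_cast hr.ne'
  -- Normalized coordinate: `w = w₀ (1 + r u)`, so the disc becomes `‖u‖ ≤ 1`.
  set u : ℂ → ℂ := fun w => (starRingEnd ℂ) w₀ * (w - w₀) / r with hu
  have hnu : ∀ w, ‖u w‖ = ‖w - w₀‖ / r := fun w => by
    simp [hu, hw₀, abs_of_pos hr]
  have huw : ∀ w, w = w₀ * (1 + r * u w) := fun w => by
    have : (r : ℂ) * u w = (starRingEnd ℂ) w₀ * (w - w₀) := by simp only [hu]; field_simp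
    rw [this]
    linear_combination (w₀ - w) * hconj
  set g : ℂ → E := fun w => (u w ^ 2 + r * u w + 1) • f w with hg
  have hgd : ∀ w ∈ Metric.closedBall w₀ r, DifferentiableAt ℂ g w := fun w hw => by
    have := hd w hw
    simp only [hg, hu]
    fun_prop
  have hbound : ∀ w ∈ Metric.sphere w₀ r, ‖g w‖ ≤ 3 * C / r := by
    intro w hw
    have hw' : ‖w - w₀‖ = r := by simpa [dist_eq_norm] using hw
    have hnu1 : ‖u w‖ = 1 := by rw [hnu, hw', div_self hr.ne']
    have huu : u w * (starRingEnd ℂ) (u w) = 1 := by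
      rw [Complex.mul_conj, Complex.normSq_eq_norm_sq, hnu1]; simp
    have hww : w * (starRingEnd ℂ) w = (‖w‖ : ℂ) ^ 2 := by
      rw [Complex.mul_conj, Complex.normSq_eq_norm_sq]; simp
    -- Since `‖u‖ = 1`, `‖w‖² - 1 = r (u + ū) + r²`; multiplying by `u` gives the quadratic, which
    -- therefore cancels the allowed blow-up exactly.
    have hkey : ((‖w‖ : ℂ) ^ 2 - 1) * u w = r * (u w ^ 2 + r * u w + 1) := by
      rw [← hww]
      have h1 : (starRingEnd ℂ) w = (starRingEnd ℂ) w₀ * (1 + r * (starRingEnd ℂ) (u w)) := by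
        conv_lhs => rw [huw w]
        simp
      rw [h1]
      nth_rw 1 [huw w]
      linear_combination (1 + r * u w) * (1 + r * (starRingEnd ℂ) (u w)) * u w * hconj
        + (r + r ^ 2 * u w) * huu
    have hnorm : ‖u w ^ 2 + r * u w + 1‖ * r = |‖w‖ - 1| * (‖w‖ + 1) := by
      have := congrArg norm hkey
      rw [norm_mul, norm_mul, hnu1, mul_one, Complex.norm_real, Real.norm_eq_abs, abs_of_pos hr,
        mul_comm r] at this
      rw [← this]
      have : ((‖w‖ : ℂ) ^ 2 - 1) = ((‖w‖ - 1 : ℝ) : ℂ) * ((‖w‖ + 1 : ℝ) : ℂ) := by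
        push_cast; ring
      rw [this, norm_mul, Complex.norm_real, Complex.norm_real, Real.norm_eq_abs,
        Real.norm_eq_abs, abs_of_pos (by positivity : 0 < ‖w‖ + 1)]
    have hw2 : ‖w‖ + 1 ≤ 3 := by
      have := norm_le_norm_add_norm_sub' w w₀
      rw [hw₀, hw'] at this
      linarith
    rw [le_div_iff₀ hr, hg, norm_smul]
    have hC0 := (by positivity : 0 ≤ ‖f w‖ * |‖w‖ - 1|).trans (hC w hw)
    calc ‖u w ^ 2 + r * u w + 1‖ * ‖f w‖ * r
        = (‖f w‖ * |‖w‖ - 1|) * (‖w‖ + 1) := by rw [mul_right_comm, hnorm]; ring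
      _ ≤ C * 3 := mul_le_mul (hC w hw) hw2 (by positivity) hC0
      _ = 3 * C := mul_comm _ _
  have hcl : closure (Metric.ball w₀ r) = Metric.closedBall w₀ r := closure_ball w₀ hr.ne'
  have hgw : ‖g w‖ ≤ 3 * C / r := by
    refine Complex.norm_le_of_forall_mem_frontier_norm_le Metric.isBounded_ball
      (DifferentiableOn.diffContOnCl ?_) (fun z hz => hbound z ?_)
      (z := w) (hcl ▸ Metric.closedBall_subset_closedBall (by linarith) hw)
    · rw [hcl]
      exact fun z hz => (hgd z hz).differentiableWithinAt
    · rwa [frontier_ball w₀ hr.ne'] at hz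
  have hu4 : ‖u w‖ ≤ 1 / 4 := by
    rw [hnu, div_le_iff₀ hr]
    have : ‖w - w₀‖ ≤ r / 4 := by simpa [dist_eq_norm] using hw
    linarith
  -- The first two terms have norm at most `1/16 + 1/4`.
  have hlow : 1 / 2 ≤ ‖u w ^ 2 + r * u w + 1‖ := by
    have h1 : ‖(1 : ℂ)‖ ≤ ‖u w ^ 2 + r * u w + 1‖ + ‖u w ^ 2 + r * u w‖ := by
      have h := norm_sub_le (u w ^ 2 + r * u w + 1) (u w ^ 2 + r * u w)
      rwa [add_sub_cancel_left] at h
    have h2 : ‖u w ^ 2 + r * u w‖ ≤ ‖u w‖ ^ 2 + r * ‖u w‖ := by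
      refine (norm_add_le _ _).trans_eq ?_
      simp [abs_of_pos hr]
    rw [norm_one] at h1
    nlinarith [norm_nonneg (u w)]
  have h3 : 1 / 2 * ‖f w‖ ≤ 3 * C / r := by
    refine le_trans ?_ hgw
    rw [hg, norm_smul]
    gcongr
  rw [le_div_iff₀ hr] at h3
  linarith

/-- An isolated singularity on the unit circle of a function with growth `C / |‖w‖ - 1|` is at most
a simple pole. -/
theorem norm_mul_norm_sub_le_of_unitCircle_growth {f : ℂ → E} {c : ℂ} (hc : ‖c‖ = 1) {δ : ℝ}
    (hδ1 : δ ≤ 1) (hd : ∀ w ∈ Metric.ball c δ, w ≠ c → DifferentiableAt ℂ f w)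
    {C : ℝ} (hC : ∀ w ∈ Metric.ball c δ, w ≠ c → ‖f w‖ * |‖w‖ - 1| ≤ C) {w : ℂ}
    (hw : w ∈ Metric.ball c (δ / 2)) (hwc : w ≠ c) : ‖f w‖ * ‖w - c‖ ≤ 16 * C := by
  set s := ‖w - c‖ with hs
  have hs0 : 0 < s := norm_pos_iff.2 (sub_ne_zero.2 hwc)
  have hsδ : s < δ / 2 := by simpa [dist_eq_norm] using hw
  have hCw := hC w (Metric.ball_subset_ball (by linarith) hw) hwc
  have hC0 : 0 ≤ C := le_trans (by positivity) hCw
  -- Far from the circle the growth bound suffices. Otherwise the disc of radius `s / 2` about the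
  -- radial projection `w₀` of `w` avoids `c`, and `w` lies in its concentric quarter.
  by_cases hfar : s / 16 ≤ |‖w‖ - 1|
  · have : ‖f w‖ * (s / 16) ≤ C := le_trans (by gcongr) hCw
    linarith
  · push Not at hfar
    have hw1 : 1 / 2 ≤ ‖w‖ := by
      have h := norm_sub_norm_le c w
      rw [hc, norm_sub_rev] at h
      linarith
    have hwpos : 0 < ‖w‖ := by linarith
    set w₀ : ℂ := w / ‖w‖ with hw₀def
    have hw₀ : ‖w₀‖ = 1 := by simp [hw₀def, hwpos.ne']
    have hww₀ : ‖w - w₀‖ = |‖w‖ - 1| := by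
      have hne : (‖w‖ : ℂ) ≠ 0 := by exact_mod_cast hwpos.ne'
      have : w - w₀ = w₀ * ((‖w‖ - 1 : ℝ) : ℂ) := by
        rw [hw₀def]; push_cast; field_simp
      rw [this, norm_mul, hw₀, one_mul, Complex.norm_real, Real.norm_eq_abs]
    have hball : ∀ z ∈ Metric.closedBall w₀ (s / 2), z ∈ Metric.ball c δ ∧ z ≠ c := by
      intro z hz
      have hz' : ‖z - w₀‖ ≤ s / 2 := by simpa [dist_eq_norm] using hz
      constructor
      · rw [Metric.mem_ball, dist_eq_norm]
        calc ‖z - c‖ = ‖(z - w₀) - (w - w₀) + (w - c)‖ := by ring_nf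
          _ ≤ ‖z - w₀‖ + ‖w - w₀‖ + ‖w - c‖ :=
            (norm_add_le _ _).trans (by gcongr; exact norm_sub_le _ _)
          _ < δ := by rw [hww₀]; linarith
      · rintro rfl
        have : s ≤ ‖w - w₀‖ + ‖z - w₀‖ := by
          rw [hs]; simpa using norm_sub_le (w - w₀) (z - w₀)
        rw [hww₀] at this
        linarith
    have h := norm_mul_le_of_unitCircle_growth hw₀ (r := s / 2) (by linarith) (by linarith)
      (fun z hz => hd z (hball z hz).1 (hball z hz).2) (C := C)
      (fun z hz => hC z (hball z (Metric.sphere_subset_closedBall hz)).1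
        (hball z (Metric.sphere_subset_closedBall hz)).2) (w := w)
      (by rw [Metric.mem_closedBall, dist_eq_norm, hww₀]; linarith)
    linarith

end CircleGrowth

/-! ### Resolvent of a doubly power-bounded element. -/

section DoublyPowerBounded

variable {B : Type*} [NormedRing B] [NormedAlgebra ℂ B]

theorem mem_resolventSet_and_resolvent_eq {a s : B} {w : ℂ} (h₁ : (algebraMap ℂ B w - a) * s = 1)
    (h₂ : s * (algebraMap ℂ B w - a) = 1) : w ∈ resolventSet ℂ a ∧ resolvent a w = s :=
  ⟨⟨⟨_, _, h₁, h₂⟩, rfl⟩, Ring.inverse_unit (⟨_, _, h₁, h₂⟩ : Bˣ)⟩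

/-- A factor `a - c` thus turns a simple pole at `c` into a bounded singularity. -/
theorem resolvent_mul_sub {a : B} {w : ℂ} (hw : w ∈ resolventSet ℂ a) (c : ℂ) :
    resolvent a w * (a - algebraMap ℂ B c) = (w - c) • resolvent a w - 1 := by
  have h : resolvent a w * (algebraMap ℂ B w - a) = 1 := Ring.inverse_mul_cancel _ hw
  have hsub : a - algebraMap ℂ B c = algebraMap ℂ B (w - c) - (algebraMap ℂ B w - a) := by
    rw [map_sub]; abel
  rw [hsub, mul_sub, h, ← Algebra.commutes, ← Algebra.smul_def]

/-- By spectral mapping `1` lies in the spectrum of the Lagrange element, whereas the spectrum of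
`0` is `{0}`. -/
theorem lagrangeElement_ne_zero {a : B} {n : ℕ} {lam : Fin n → ℂ}
    (hlam : Function.Injective lam) {i : Fin n} (hi : lam i ∈ spectrum ℂ a) :
    lagrangeElement a lam i ≠ 0 := by
  intro h
  have hmem := spectrum.subset_polynomial_aeval a (Lagrange.basis Finset.univ lam i) ⟨_, hi, rfl⟩
  have hnt : Nontrivial B := by
    by_contra hB
    rw [not_nontrivial_iff_subsingleton] at hB
    exact hi (isUnit_of_subsingleton _)
  rw [aeval_lagrangeBasis, h, spectrum.zero_eq] at hmem
  simp [Lagrange.eval_basis_self hlam.injOn (Finset.mem_univ i)] at hmem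

variable [CompleteSpace B]

theorem exists_inverse_one_sub_smul {u : B} {M : ℝ} (hu : ∀ k : ℕ, ‖u ^ k‖ ≤ M) {z : ℂ}
    (hz : ‖z‖ < 1) :
    ∃ s : B, (1 - z • u) * s = 1 ∧ s * (1 - z • u) = 1 ∧ ‖s‖ * (1 - ‖z‖) ≤ M := by
  have hle : ∀ k : ℕ, ‖(z • u) ^ k‖ ≤ ‖z‖ ^ k * M := fun k => by
    rw [_root_.smul_pow, norm_smul, norm_pow]
    exact mul_le_mul_of_nonneg_left (hu k) (by positivity)
  have hgeom := (hasSum_geometric_of_lt_one (norm_nonneg z) hz).mul_right M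
  have hsum : Summable fun k : ℕ => (z • u) ^ k := .of_norm_bounded hgeom.summable hle
  refine ⟨∑' k : ℕ, (z • u) ^ k, hsum.one_sub_mul_tsum_pow, hsum.tsum_pow_mul_one_sub, ?_⟩
  have h := tsum_of_norm_bounded hgeom hle
  have hpos : 0 < 1 - ‖z‖ := by linarith
  calc _ ≤ (1 - ‖z‖)⁻¹ * M * (1 - ‖z‖) := by gcongr
    _ = M := by field_simp

/-- The resolvent of a doubly power-bounded element grows at most like `C / |‖w‖ - 1|`. -/
theorem IsDoublyPowerBounded.exists_norm_resolvent_le {b : Bˣ} (hb : IsDoublyPowerBounded b) :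
    ∃ C : ℝ, 0 ≤ C ∧ (∀ w : ℂ, ‖w‖ ≠ 1 → w ∈ resolventSet ℂ (b : B)) ∧
      ∀ w : ℂ, ‖resolvent (b : B) w‖ * |‖w‖ - 1| ≤ C := by
  obtain ⟨M, hM⟩ := hb
  replace hM : ∀ k : ℤ, ‖((b ^ k : Bˣ) : B)‖ ≤ M := fun k => hM ⟨k, rfl⟩
  have hM0 : 0 ≤ M := (norm_nonneg _).trans (hM 0)
  have hpow : ∀ k : ℕ, ‖(b : B) ^ k‖ ≤ M := fun k => by simpa using hM k
  have hpow' : ∀ k : ℕ, ‖((b⁻¹ : Bˣ) : B) ^ k‖ ≤ M := fun k => by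
    simpa [← inv_pow] using hM (-k)
  have hinv : ‖((b⁻¹ : Bˣ) : B)‖ ≤ M := by simpa using hpow' 1
  have key : ∀ w : ℂ, ‖w‖ ≠ 1 → w ∈ resolventSet ℂ (b : B) ∧
      ‖resolvent (b : B) w‖ * |‖w‖ - 1| ≤ M + M * M := by
    intro w hw
    rcases lt_or_gt_of_ne hw with hlt | hgt
    -- Inside the circle the series runs in `b⁻¹`, and the extra factor `b⁻¹` costs the second `M`.
    · obtain ⟨s, h1, h2, h3⟩ := exists_inverse_one_sub_smul hpow' hlt
      have hfac : algebraMap ℂ B w - b = -(b : B) * (1 - w • ((b⁻¹ : Bˣ) : B)) := by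
        rw [mul_sub, mul_smul_comm, neg_mul, neg_mul, Units.mul_inv, Algebra.algebraMap_eq_smul_one]
        simp [add_comm, sub_eq_add_neg]
      have hfac' : algebraMap ℂ B w - b = (1 - w • ((b⁻¹ : Bˣ) : B)) * -(b : B) := by
        rw [sub_mul, smul_mul_assoc, mul_neg, mul_neg, Units.inv_mul, Algebra.algebraMap_eq_smul_one]
        simp [add_comm, sub_eq_add_neg]
      obtain ⟨hmem, heq⟩ := mem_resolventSet_and_resolvent_eq (a := (b : B)) (w := w)
        (s := -((b⁻¹ : Bˣ) : B) * s)
        (by rw [hfac', mul_assoc, ← mul_assoc (-(b : B)), neg_mul_neg, Units.mul_inv, one_mul, h1])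
        (by rw [hfac', mul_assoc, ← mul_assoc s, h2, one_mul, neg_mul_neg, Units.inv_mul])
      refine ⟨hmem, ?_⟩
      rw [heq, abs_of_neg (by linarith), neg_sub]
      calc ‖-((b⁻¹ : Bˣ) : B) * s‖ * (1 - ‖w‖)
          ≤ ‖((b⁻¹ : Bˣ) : B)‖ * ‖s‖ * (1 - ‖w‖) := by
            have : 0 ≤ 1 - ‖w‖ := by linarith
            gcongr
            simpa using norm_mul_le (-((b⁻¹ : Bˣ) : B)) s
        _ = ‖((b⁻¹ : Bˣ) : B)‖ * (‖s‖ * (1 - ‖w‖)) := mul_assoc _ _ _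
        _ ≤ M * M := by
            refine mul_le_mul hinv h3 (mul_nonneg (norm_nonneg _) (by linarith)) hM0
        _ ≤ M + M * M := by linarith
    · have hwpos : 0 < ‖w‖ := by linarith
      have hw0 : w ≠ 0 := norm_pos_iff.1 hwpos
      obtain ⟨s, h1, h2, h3⟩ := exists_inverse_one_sub_smul hpow (z := w⁻¹)
        (by rw [norm_inv]; exact inv_lt_one_of_one_lt₀ hgt)
      have hfac : algebraMap ℂ B w - b = w • (1 - w⁻¹ • (b : B)) := by
        rw [smul_sub, smul_smul, mul_inv_cancel₀ hw0, one_smul, Algebra.algebraMap_eq_smul_one]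
      obtain ⟨hmem, heq⟩ := mem_resolventSet_and_resolvent_eq (a := (b : B)) (w := w)
        (s := w⁻¹ • s)
        (by rw [hfac, smul_mul_smul_comm, mul_inv_cancel₀ hw0, one_smul, h1])
        (by rw [hfac, smul_mul_smul_comm, inv_mul_cancel₀ hw0, one_smul, h2])
      refine ⟨hmem, ?_⟩
      rw [heq, abs_of_pos (by linarith), norm_smul]
      rw [norm_inv] at h3 ⊢
      calc ‖w‖⁻¹ * ‖s‖ * (‖w‖ - 1) = ‖s‖ * (1 - ‖w‖⁻¹) := by field_simp
        _ ≤ M := h3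
        _ ≤ M + M * M := by nlinarith
  refine ⟨M + M * M, by positivity, fun w hw => (key w hw).1, fun w => ?_⟩
  by_cases hw : ‖w‖ = 1
  · simp only [hw, sub_self, abs_zero, mul_zero]; positivity
  · exact (key w hw).2

theorem IsDoublyPowerBounded.norm_eq_one_of_mem_spectrum {b : Bˣ} (hb : IsDoublyPowerBounded b)
    {w : ℂ} (hw : w ∈ spectrum ℂ (b : B)) : ‖w‖ = 1 := by
  obtain ⟨C, -, hmem, -⟩ := hb.exists_norm_resolvent_le
  by_contra h
  exact hw (hmem w h)

/-- A doubly power-bounded element with finite spectrum is annihilated by the polynomial whose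
simple roots are the points of the spectrum. -/
theorem IsDoublyPowerBounded.aeval_nodal_eq_zero {b : Bˣ} (hb : IsDoublyPowerBounded b)
    {n : ℕ} {lam : Fin n → ℂ} (hspec : spectrum ℂ (b : B) = Set.range lam) :
    aeval (b : B) (Lagrange.nodal Finset.univ lam) = 0 := by
  obtain ⟨C, hC0, -, hC⟩ := hb.exists_norm_resolvent_le
  set q := aeval (b : B) (Lagrange.nodal Finset.univ lam) with hq
  have hfin : (spectrum ℂ (b : B)).Finite := hspec ▸ Set.finite_range lam
  have hd : ∀ w ∉ spectrum ℂ (b : B), DifferentiableAt ℂ (resolvent (b : B)) w := fun w hw =>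
    (spectrum.hasDerivAt_resolvent_const_left (not_not.1 hw)).differentiableAt
  have h0 : (0 : ℂ) ∉ spectrum ℂ (b : B) := fun h => by
    simpa using hb.norm_eq_one_of_mem_spectrum h
  -- One point of the resolvent set is enough, since the resolvent is invertible there.
  have hzero : resolvent (b : B) (0 : ℂ) * q = 0 := by
    refine eq_zero_of_tendsto_cocompact_of_finite (f := fun w => resolvent (b : B) w * q) hfin
      (fun w hw => (hd w hw).mul_const q) (fun c hc => ?_) ?_ h0
    · have hopen : IsOpen (spectrum ℂ (b : B) \ {c})ᶜ :=
        (hfin.subset Set.sdiff_subset).isClosed.isOpen_compl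
      obtain ⟨δ, hδ, hδsub⟩ := Metric.isOpen_iff.1 hopen c (by simp)
      have hres : ∀ w ∈ Metric.ball c (min δ 1), w ≠ c → w ∉ spectrum ℂ (b : B) :=
        fun w hw hwc hws =>
          hδsub (Metric.ball_subset_ball (min_le_left _ _) hw) ⟨hws, hwc⟩
      obtain ⟨j, rfl⟩ := hspec ▸ hc
      obtain ⟨r, hr⟩ := Lagrange.X_sub_C_dvd_nodal lam (Finset.mem_univ j)
      have hqr : q = ((b : B) - algebraMap ℂ B (lam j)) * aeval (b : B) r := by
        rw [hq, hr, map_mul]; simp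
      refine ⟨min δ 1 / 2, by positivity, (16 * C + ‖(1 : B)‖) * ‖aeval (b : B) r‖,
        fun w hw hwc => ?_⟩
      have hw' : w ∈ Metric.ball (lam j) (min δ 1) :=
        Metric.ball_subset_ball (half_le_self (by positivity)) hw
      have hpole := norm_mul_norm_sub_le_of_unitCircle_growth
        (hb.norm_eq_one_of_mem_spectrum hc) (min_le_right δ 1)
        (fun z hz hzc => hd z (hres z hz hzc)) (fun z _ _ => hC z) hw hwc
      rw [hqr, ← mul_assoc, resolvent_mul_sub (not_not.1 (hres w hw' hwc))]
      refine (norm_mul_le _ _).trans ?_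
      gcongr
      refine (norm_sub_le _ _).trans ?_
      gcongr
      rwa [norm_smul, mul_comm]
    · rw [← Metric.cobounded_eq_cocompact]
      simpa using (spectrum.resolvent_tendsto_cobounded (b : B)).mul_const q
  have hinv : (algebraMap ℂ B 0 - b) * resolvent (b : B) (0 : ℂ) = 1 :=
    Ring.mul_inverse_cancel _ (not_not.1 h0)
  rw [← one_mul q, ← hinv, mul_assoc, hzero, mul_zero]

end DoublyPowerBounded

/-! ### Integrals and winding numbers along Lipschitz contours. -/

section ContourIntegrals

open Set

theorem LipschitzWith.path_extend {a b : ℂ} {γ : Path a b} {K : NNReal} (hγ : LipschitzWith K γ) :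
    LipschitzWith K γ.extend := by
  have h := hγ.comp (LipschitzWith.projIcc (zero_le_one (α := ℝ)))
  rwa [mul_one] at h

theorem intervalIntegrable_deriv_path_mul {a b : ℂ} {γ : Path a b} {K : NNReal}
    (hγ : LipschitzWith K γ) {f : ℂ → ℂ} (hf : ContinuousOn f (range γ)) :
    IntervalIntegrable (fun t => deriv γ.extend t * f (γ.extend t)) MeasureTheory.volume 0 1 := by
  have hderiv : IntervalIntegrable (deriv γ.extend) MeasureTheory.volume 0 1 := by
    refine (intervalIntegrable_const (c := (K : ℝ))).mono_fun
      (measurable_deriv _).aestronglyMeasurable (Filter.Eventually.of_forall fun t => ?_)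
    simpa using norm_deriv_le_of_lipschitz hγ.path_extend
  refine hderiv.mul_continuousOn (hf.comp γ.continuous_extend.continuousOn fun t _ => ?_)
  rw [← γ.extend_range]
  exact mem_range_self t

theorem curveIntegral_toSpanSingleton {E : Type*} [NormedAddCommGroup E] [NormedSpace ℂ E]
    {a b : ℂ} (f : ℂ → E) (γ : Path a b) :
    curveIntegral (fun w => ContinuousLinearMap.toSpanSingleton ℂ (f w)) γ =
      ∫ t in (0 : ℝ)..1, deriv γ.extend t • f (γ.extend t) := by
  rw [curveIntegral_eq_intervalIntegral_deriv]
  rfl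

namespace Contour

theorem integral_congr {E : Type*} [NormedAddCommGroup E] [NormedSpace ℂ E] {Γ : Contour}
    {f g : ℂ → E} (h : EqOn f g Γ.trace) : Γ.integral f = Γ.integral g := by
  refine Finset.sum_congr rfl fun k _ => ?_
  rw [curveIntegral_toSpanSingleton, curveIntegral_toSpanSingleton]
  refine intervalIntegral.integral_congr fun t _ => ?_
  have ht : (Γ.path k).extend t ∈ Γ.trace :=
    mem_iUnion.2 ⟨k, (Γ.path k).extend_range ▸ mem_range_self t⟩
  simp only [h ht]

theorem integral_sum_smul {E : Type*} [NormedAddCommGroup E] [NormedSpace ℂ E] [CompleteSpace E]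
    {ι : Type*} (s : Finset ι) (Γ : Contour) {g : ι → ℂ → ℂ}
    (hg : ∀ j ∈ s, ContinuousOn (g j) Γ.trace) (v : ι → E) :
    (Γ.integral fun w => ∑ j ∈ s, g j w • v j) = ∑ j ∈ s, Γ.integral (g j) • v j := by
  simp only [integral, curveIntegral_toSpanSingleton, Finset.smul_sum, smul_smul, smul_eq_mul,
    Finset.sum_smul]
  rw [Finset.sum_comm]
  refine Finset.sum_congr rfl fun k _ => ?_
  obtain ⟨K, hK⟩ := Γ.lipschitz k
  have hint : ∀ j ∈ s, IntervalIntegrable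
      (fun t => deriv (Γ.path k).extend t * g j ((Γ.path k).extend t)) MeasureTheory.volume 0 1 :=
    fun j hj => intervalIntegrable_deriv_path_mul hK
      ((hg j hj).mono (subset_iUnion (fun k => range (Γ.path k)) k))
  rw [intervalIntegral.integral_finsetSum fun j hj =>
    ⟨(hint j hj).1.smul_const (v j), (hint j hj).2.smul_const (v j)⟩]
  exact Finset.sum_congr rfl fun j _ => intervalIntegral.integral_smul_const _ _

/-- The positively oriented circle, as a closed path on the unit interval. -/
noncomputable def circlePath (c : ℂ) (r : ℝ) : Path (circleMap c r 0) (circleMap c r 0) where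
  toFun t := circleMap c r (2 * Real.pi * t)
  continuous_toFun := by fun_prop
  source' := by simp
  target' := by simp [circleMap]

/-- The positively oriented circle as a contour. -/
noncomputable def circle (c : ℂ) (r : ℝ) : Contour where
  size := 1
  base _ := circleMap c r 0
  path _ := circlePath c r
  lipschitz _ := by
    refine ⟨_, (lipschitzWith_circleMap c r).comp
      ((lipschitzWith_smul (2 * Real.pi)).comp (LipschitzWith.subtype_val _))⟩

theorem circle_trace_subset (c : ℂ) {r : ℝ} (hr : 0 ≤ r) :
    (circle c r).trace ⊆ Metric.sphere c r := by
  refine iUnion_subset fun _ => ?_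
  rintro _ ⟨t, rfl⟩
  exact circleMap_mem_sphere c hr _

theorem integral_circle {E : Type*} [NormedAddCommGroup E] [NormedSpace ℂ E] (c : ℂ) (r : ℝ)
    (f : ℂ → E) : (circle c r).integral f = circleIntegral f c r := by
  have h1 : (circle c r).integral f =
      ∫ t in (0 : ℝ)..1, deriv (circlePath c r).extend t • f ((circlePath c r).extend t) := by
    rw [← curveIntegral_toSpanSingleton]
    exact Fin.sum_univ_one _
  have hpi : (2 * Real.pi) ≠ 0 := by positivity
  have hscale := intervalIntegral.smul_integral_comp_mul_left (a := 0) (b := 1)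
    (fun θ : ℝ => deriv (circleMap c r) θ • f (circleMap c r θ)) (2 * Real.pi)
  rw [mul_zero, mul_one] at hscale
  rw [h1, circleIntegral, ← hscale, ← intervalIntegral.integral_smul]
  refine intervalIntegral.integral_congr_ae_restrict ?_
  -- The endpoint is discarded because the extended path is constant outside `[0, 1]` and has a
  -- corner there when `r ≠ 0`.
  rw [uIoc_of_le zero_le_one, ← MeasureTheory.restrict_Ioo_eq_restrict_Ioc]
  filter_upwards [MeasureTheory.ae_restrict_mem measurableSet_Ioo] with t ht
  have hext : ∀ s ∈ Ioo (0 : ℝ) 1, (circlePath c r).extend s = circleMap c r (2 * Real.pi * s) :=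
    fun s hs => Path.extend_apply _ (Ioo_subset_Icc_self hs)
  have hd : HasDerivAt (fun s : ℝ => circleMap c r (2 * Real.pi * s))
      ((2 * Real.pi) • (deriv (circleMap c r) (2 * Real.pi * t))) t := by
    have h := ((hasDerivAt_circleMap c r (2 * Real.pi * t)).differentiableAt.hasDerivAt).scomp t
      ((hasDerivAt_id t).const_mul (2 * Real.pi))
    simpa [Function.comp_def] using h
  have heq : (circlePath c r).extend =ᶠ[nhds t] fun s => circleMap c r (2 * Real.pi * s) := by
    filter_upwards [isOpen_Ioo.mem_nhds ht] with s hs using hext s hs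
  rw [hext t ht, heq.deriv_eq, hd.deriv, smul_assoc]

theorem windingNumber_circle_self (c : ℂ) {r : ℝ} (hr : 0 < r) :
    (circle c r).windingNumber c = 1 := by
  rw [windingNumber, integral_circle, circleIntegral.integral_sub_center_inv c hr.ne',
    inv_mul_cancel₀ Complex.two_pi_I_ne_zero]

theorem windingNumber_circle_of_notMem {c z : ℂ} {r : ℝ} (hr : 0 ≤ r)
    (hz : z ∉ Metric.closedBall c r) : (circle c r).windingNumber z = 0 := by
  have hne : ∀ w ∈ Metric.closedBall c r, w - z ≠ 0 := by
    intro w hw h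
    exact hz (sub_eq_zero.1 h ▸ hw)
  rw [windingNumber, integral_circle,
    Complex.circleIntegral_eq_zero_of_differentiable_on_off_countable hr countable_empty, mul_zero]
  · exact ContinuousOn.inv₀ (by fun_prop) hne
  · intro w hw
    exact DifferentiableAt.inv (by fun_prop) (hne w (Metric.ball_subset_closedBall hw.1))

end Contour

end ContourIntegrals

/-! ### Riesz projections. -/

section RieszProjection

variable {B : Type*} [NormedRing B] [NormedAlgebra ℂ B] {n : ℕ} {b : B} {lam : Fin n → ℂ}
  {p : Fin n → B}

theorem Contour.exists_separates {a : B} {c : ℂ} {ε : ℝ} (hε : 0 < ε)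
    (h : Metric.ball c ε ∩ spectrum ℂ a = {c}) : ∃ Γ : Contour, Γ.Separates a c := by
  have hball : ∀ z ∈ spectrum ℂ a, z ≠ c → z ∉ Metric.closedBall c (ε / 2) := by
    intro z hz hzc hzb
    have hmem : z ∈ Metric.ball c ε ∩ spectrum ℂ a :=
      ⟨Metric.closedBall_subset_ball (half_lt_self hε) hzb, hz⟩
    rw [h] at hmem
    exact hzc hmem
  refine ⟨circle c (ε / 2), fun w hw => ?_, windingNumber_circle_self c (by positivity),
    fun z hz hzc => windingNumber_circle_of_notMem (by positivity) (hball z hz hzc)⟩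
  have hw' := circle_trace_subset c (by positivity) hw
  refine not_not.1 fun hws => hball w hws ?_ (Metric.sphere_subset_closedBall hw')
  rintro rfl
  rw [Metric.mem_sphere, dist_self] at hw'
  linarith

/-- On the contour the resolvent is `∑ (w - lam j)⁻¹ • p j`, so the normalized integral is the sum
of the `p j` weighted by winding numbers, and only `p i` survives. -/
theorem IsSpectralDecomposition.isRieszProjection [CompleteSpace B]
    (h : IsSpectralDecomposition b lam p) (hlam : Function.Injective lam) (i : Fin n) :
    IsRieszProjection b (lam i) (p i) := by
  have hspec := h.spectrum_eq
  have hisol : ∃ ε : ℝ, 0 < ε ∧ Metric.ball (lam i) ε ∩ spectrum ℂ b = {lam i} := by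
    have hfin : (spectrum ℂ b).Finite := hspec ▸ Set.finite_range lam
    have hopen : IsOpen (spectrum ℂ b \ {lam i})ᶜ :=
      (hfin.subset Set.sdiff_subset).isClosed.isOpen_compl
    obtain ⟨ε, hε, hsub⟩ := Metric.isOpen_iff.1 hopen (lam i) (by simp)
    refine ⟨ε, hε, Set.Subset.antisymm (fun w hw => ?_) ?_⟩
    · by_contra hwi
      exact hsub hw.1 ⟨hw.2, hwi⟩
    · rintro _ rfl
      exact ⟨Metric.mem_ball_self hε, hspec ▸ Set.mem_range_self i⟩
  refine ⟨hisol, ?_, fun Γ hΓ => ?_⟩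
  · obtain ⟨ε, hε, hball⟩ := hisol
    exact Contour.exists_separates hε hball
  · obtain ⟨htrace, hself, hother⟩ := hΓ
    have hnot : ∀ w ∈ Γ.trace, w ∉ Set.range lam := fun w hw hwr =>
      (hspec ▸ hwr : w ∈ spectrum ℂ b) (htrace hw)
    rw [Contour.integral_congr fun w hw => h.resolvent_eq (hnot w hw),
      Contour.integral_sum_smul Finset.univ Γ (g := fun j w => (w - lam j)⁻¹) ?_ p,
      Finset.smul_sum]
    · simp_rw [smul_smul]
      rw [Finset.sum_eq_single i]
      · exact (by rw [← Contour.windingNumber, hself, one_smul] :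
          p i = ((2 * (Real.pi : ℂ) * Complex.I)⁻¹ * Γ.integral fun w => (w - lam i)⁻¹) • p i)
      · intro j _ hj
        rw [← Contour.windingNumber,
          hother (lam j) (hspec ▸ Set.mem_range_self j) (hlam.ne hj), zero_smul]
      · simp
    · intro j _
      refine ContinuousOn.inv₀ (by fun_prop) fun w hw hwj => hnot w hw ⟨j, ?_⟩
      exact (sub_eq_zero.1 hwj).symm

end RieszProjection

theorem theorem3p2 {B : Type*} [NormedRing B] [NormedAlgebra ℂ B] [CompleteSpace B]
    (b : Bˣ) {n : ℕ} (lam : Fin n → ℂ) (hlam : Function.Injective lam) :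
    List.TFAE
      [ IsDoublyPowerBounded b ∧ spectrum ℂ (b : B) = Set.range lam,
        (∀ j, lam j ∈ Metric.sphere (0 : ℂ) 1) ∧
          ∃ p : Fin n → B, IsSpectralDecomposition (b : B) lam p,
        (∀ j, lam j ∈ Metric.sphere (0 : ℂ) 1) ∧
          ((List.finRange n).map fun j => (b : B) - algebraMap ℂ B (lam j)).prod = 0 ∧
          ∀ i, lagrangeElement (b : B) lam i ≠ 0 ] ∧
    ((∀ j, lam j ∈ Metric.sphere (0 : ℂ) 1) →
      ∀ p : Fin n → B, IsSpectralDecomposition (b : B) lam p →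
        ∀ i, p i = lagrangeElement (b : B) lam i ∧
          (1 < n → IsRieszProjection (b : B) (lam i) (p i))) := by
  refine ⟨?_, fun _ p hp i => ⟨hp.eq_lagrangeElement hlam i,
    fun _ => hp.isRieszProjection hlam i⟩⟩
  tfae_have 1 → 3 := by
    rintro ⟨hb, hspec⟩
    have hmem : ∀ j, lam j ∈ spectrum ℂ (b : B) := fun j => hspec ▸ Set.mem_range_self j
    refine ⟨fun j => ?_, ?_, fun i => lagrangeElement_ne_zero hlam (hmem i)⟩
    · simpa using hb.norm_eq_one_of_mem_spectrum (hmem j)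
    · rw [← aeval_nodal_univ]
      exact hb.aeval_nodal_eq_zero hspec
  tfae_have 3 → 2 := fun ⟨hT, h0, hne⟩ =>
    ⟨hT, _, isSpectralDecomposition_lagrangeElement hlam h0 hne⟩
  tfae_have 2 → 1 := fun ⟨hT, _, hp⟩ => ⟨hp.isDoublyPowerBounded hT, hp.spectrum_eq⟩
  tfae_finish
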